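/- **Conventions.** A metric measure space with boundary is a triple $X=(X,d_X,\mu_X)$, where $X$ is a Riemannian manifold with boundary $\partial X$, $d_X$ is the Riemannian distance and $\mu_X$ is a Borel probability measure. For $\Omega\subset X$ put $\operatorname{InRad}\Omega:=\sup_{x\in\Omega}d_X(x,\partial X)$, and $\operatorname{InRad}\emptyset:=0$. For $\xi\le 1$ let $\operatorname{PartInRad}(X;\xi)$ be the infimum of $\operatorname{InRad}\Omega$ over all Borel sets $\Omega\subset X$ with $\mu_X(\Omega)\ge\xi$. For $\eta>0$ let $$\operatorname{ObsInRad}(X;-\eta):=\sup_{\varphi}\operatorname{PartInRad}\bigl(([0,\infty),|\cdot|,\varphi_\#\mu_X);1-\eta\bigr),$$ where $\varphi$ runs over all $1$-Lipschitz functions $\varphi:X\to[0,\infty)$ with $\varphi|_{\partial X}=0$, and $[0,\infty)$ has boundary $\{0\}$. A sequence $\{X_n\}$ is a *boundary concentration family* if $\lim_{n\to\infty}\operatorname{ObsInRad}(X_n;-\eta)=0$ for every $\eta>0$. For $n\ge 2$, $\kappa<0$ and $\lambda=\sqrt{|\kappa|}$ let $M^n_{\kappa,\lambda}$ be the manifold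 with boundary $[0,\infty)\times\mathbb S^{n-1}$ with the warped product metric $dt^2+e^{-2\lambda t}ds_{n-1}^2$, where $ds_{n-1}^2$ is the metric of the unit sphere $\mathbb S^{n-1}\subset\mathbb R^n$, equipped with its Riemannian distance and its Riemannian volume measure normalized to total mass $1$. For $\Lambda>0$ let $E_\Lambda:=([0,\infty),|\cdot|,\Lambda e^{-\Lambda t}dt)$, with boundary $\{0\}$. **Theorem.** (1) Let $\kappa<0$ and $\lambda=\sqrt{|\kappa|}$. Then for every $\eta\in(0,1]$ and every $n\ge 2$ $$\operatorname{ObsInRad}(M^n_{\kappa/n^2,\lambda/n};-\eta)=\frac{n}{(n-1)\lambda}\log\frac1\eta,$$ and $$\lim_{n\to\infty}\operatorname{ObsInRad}(M^n_{\kappa/n^2,\lambda/n};-\eta)=\operatorname{PartInRad}(E_\lambda;1-\eta)=\frac1\lambda\log\frac1\eta .$$ (2) Let $\kappa_n<0$ and $\lambda_n=\sqrt{|\kappa_n|}$ for all $n\ge 2$. Then the sequence $\{M^n_{\kappa_n,\lambda_n}\}$ is a boundary concentration family if and only if $n\lambda_n\to\infty$ as $n\to\infty$. -/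

import Mathlib

open Set Filter Topology MeasureTheory Manifold Bundle Bornology
open scoped ENNReal NNReal ContDiff

noncomputable section

namespace BoundaryConcentration

/-! Invariants of a metric measure space with boundary. Each of them depends only on the metric,
on the boundary `bd` and on the measure `μ`. All values lie in `[0, ∞]`. -/

section Invariants

variable {X : Type*} [PseudoEMetricSpace X]

/-- The inscribed radius of a subset `Ω`: the supremum over `Ω` of the distance to the boundary,
which is `0` if `Ω` is empty. -/
def inRad (bd : Set X) (Ω : Set X) : ℝ≥0∞ := ⨆ x ∈ Ω, Metric.infEDist x bd

/-- The `ξ`-partial inscribed radius: the infimum of the inscribed radii of the Borel subsets of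
measure at least `ξ`. -/
def partInRad [MeasurableSpace X] (bd : Set X) (μ : Measure X) (ξ : ℝ) : ℝ≥0∞ :=
  ⨅ (Ω : Set X) (_ : MeasurableSet Ω) (_ : ENNReal.ofReal ξ ≤ μ Ω), inRad bd Ω

/-- The `η`-observable inscribed radius `ObsInRad(X; -η)`: the supremum, over the 1-Lipschitz
functions `φ : X → [0, ∞)` that vanish on the boundary, of the `(1 - η)`-partial inscribed radius
of the screen `([0, ∞), |·|, φ_# μ)`, whose boundary is `{0}`. -/
def obsInRad [MeasurableSpace X] (bd : Set X) (μ : Measure X) (η : ℝ) : ℝ≥0∞ :=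
  ⨆ (φ : X → ℝ≥0) (_ : LipschitzWith 1 φ) (_ : ∀ x ∈ bd, φ x = 0),
    partInRad {(0 : ℝ≥0)} (μ.map φ) (1 - η)

/-- A sequence of metric measure spaces with boundary is a boundary concentration family if
`ObsInRad(X_n; -η) → 0` for every `η > 0`. -/
def IsBoundaryConcentrationFamily {X : ℕ → Type*} [∀ n, PseudoEMetricSpace (X n)]
    [∀ n, MeasurableSpace (X n)] (bd : ∀ n, Set (X n)) (μ : ∀ n, Measure (X n)) : Prop :=
  ∀ η : ℝ, 0 < η → Tendsto (fun n ↦ obsInRad (bd n) (μ n) η) atTop (𝓝 0)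

end Invariants

/-- The Lebesgue measure on `[0, ∞)`. -/
def halfLineVolume : Measure ℝ≥0 := Measure.comap ((↑) : ℝ≥0 → ℝ) volume

/-- The measure `Λ e^{-Λ t} dt` on `[0, ∞)` of the exponential model space `E_Λ`. -/
def expMeasure (Λ : ℝ) : Measure ℝ≥0 :=
  halfLineVolume.withDensity fun t ↦ ENNReal.ofReal (Λ * Real.exp (-(Λ * (t : ℝ))))

/-! Bilinear forms of warped product type on tangent spaces, and their smoothness. -/

section Forms

variable {E H M F : Type*} [NormedAddCommGroup E] [NormedSpace ℝ E] [TopologicalSpace H]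
  {I : ModelWithCorners ℝ E H} [TopologicalSpace M] [ChartedSpace H M]
  [NormedAddCommGroup F] [InnerProductSpace ℝ F]

/-- The bilinear form `(v, w) ↦ ⟪L v, L w⟫`. -/
def innerComp (L : E →L[ℝ] F) : E →L[ℝ] E →L[ℝ] ℝ :=
  ContinuousLinearMap.bilinearComp (innerSL ℝ (E := F) : F →L[ℝ] F →L[ℝ] ℝ) L L

theorem innerComp_apply (L : E →L[ℝ] F) (v w : E) : innerComp L v w = inner ℝ (L v) (L w) := rfl

theorem contDiff_innerComp : ContDiff ℝ ∞ (innerComp : (E →L[ℝ] F) → _) := by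
  have : (innerComp : (E →L[ℝ] F) → _) = fun L =>
    ((ContinuousLinearMap.compL ℝ E F ℝ).flip L).comp
      ((innerSL ℝ (E := F) : F →L[ℝ] F →L[ℝ] ℝ).comp L) := by
    ext L v w; rfl
  rw [this]
  fun_prop

/-- The bilinear form `(v, w) ↦ A v * A w + c * ⟪B v, B w⟫`. -/
def warpComb (q : ℝ × (E →L[ℝ] ℝ) × (E →L[ℝ] F)) : E →L[ℝ] E →L[ℝ] ℝ :=
  innerComp q.2.1 + q.1 • innerComp q.2.2

theorem contDiff_warpComb : ContDiff ℝ ∞ (warpComb : ℝ × (E →L[ℝ] ℝ) × (E →L[ℝ] F) → _) := by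
  have h : ContDiff ℝ ∞ (fun q : ℝ × (E →L[ℝ] ℝ) × (E →L[ℝ] F) =>
      ((ContinuousLinearMap.compL ℝ E F ℝ).flip q.2.2).comp
        ((innerSL ℝ (E := F) : F →L[ℝ] F →L[ℝ] ℝ).comp (q.1 • q.2.2))) := by
    fun_prop
  convert! (contDiff_innerComp.comp (contDiff_fst.comp contDiff_snd)).add h using 1
  ext q v w
  simp [warpComb, innerComp]

/-- For a real function `h` and a vector-valued function `a` on a manifold, the bilinear form
`dh ⊗ dh + e^{-2 lam h} ⟪da, da⟫` on the tangent space at `p`. -/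
def warpedForm (I : ModelWithCorners ℝ E H) (lam : ℝ) (h : M → ℝ) (a : M → F) (p : M) :
    TangentSpace I p →L[ℝ] TangentSpace I p →L[ℝ] ℝ :=
  let dh : E →L[ℝ] ℝ := mvfderiv I h p
  let da : E →L[ℝ] F := mvfderiv I a p
  let B : E →L[ℝ] E →L[ℝ] ℝ := warpComb (Real.exp (-(2 * lam * h p)), dh, da)
  B

theorem warpedForm_apply (lam : ℝ) (h : M → ℝ) (a : M → F) (p : M) (v w : TangentSpace I p) :
    warpedForm I lam h a p v w = mvfderiv I h p v * mvfderiv I h p w +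
      Real.exp (-(2 * lam * h p)) * inner ℝ (mvfderiv I a p v) (mvfderiv I a p w) := by
  rw [mul_comm (mvfderiv I h p v)]
  rfl

theorem inTangentCoordinates_mfderiv (f : M → F) [IsManifold I 1 M] (x b : M) (u : E) :
    inTangentCoordinates I 𝓘(ℝ, F) id f (mfderiv I 𝓘(ℝ, F) f) x b u =
      mvfderiv I f b (Trivialization.symmL ℝ (trivializationAt E (TangentSpace I) x) b u) := by
  simp [inTangentCoordinates, ContinuousLinearMap.inCoordinates]
  rfl

theorem continuousLinearMapAt_hom_apply [IsManifold I 1 M] {x b : M}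
    (hb : b ∈ (trivializationAt E (TangentSpace I) x).baseSet) (ψ : TangentSpace I b →L[ℝ] ℝ)
    (w : E) :
    (Trivialization.continuousLinearMapAt ℝ
        (trivializationAt (E →L[ℝ] ℝ) (fun x ↦ TangentSpace I x →L[ℝ] ℝ) x) b ψ) w =
      ψ (Trivialization.symmL ℝ (trivializationAt E (TangentSpace I) x) b w) := by
  have hb' : b ∈ (trivializationAt (E →L[ℝ] ℝ) (fun x ↦ TangentSpace I x →L[ℝ] ℝ) x).baseSet :=
    ⟨hb, mem_univ b⟩
  refine (congrArg (fun φ : E →L[ℝ] ℝ ↦ φ w)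
    (congrFun (Trivialization.coe_linearMapAt_of_mem _ hb') ψ)).trans ?_
  change (ContinuousLinearMap.inCoordinates E (TangentSpace I) ℝ (fun _ : M ↦ ℝ) x b x b ψ) w = _
  simp [ContinuousLinearMap.inCoordinates]

theorem warpComb_apply (c : ℝ) (A : E →L[ℝ] ℝ) (B : E →L[ℝ] F) (v w : E) :
    warpComb (c, A, B) v w = A v * A w + c * inner ℝ (B v) (B w) := by
  rw [mul_comm (A v)]
  rfl

theorem warpedForm_symmL [IsManifold I 1 M] (lam : ℝ) (h : M → ℝ) (a : M → F) (x b : M) (v w : E) :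
    warpedForm I lam h a b
      (Trivialization.symmL ℝ (trivializationAt E (TangentSpace I) x) b v)
      (Trivialization.symmL ℝ (trivializationAt E (TangentSpace I) x) b w) =
    warpComb (Real.exp (-(2 * lam * h b)),
      inTangentCoordinates I 𝓘(ℝ, ℝ) id h (mfderiv I 𝓘(ℝ, ℝ) h) x b,
      inTangentCoordinates I 𝓘(ℝ, F) id a (mfderiv I 𝓘(ℝ, F) a) x b) v w := by
  refine (warpedForm_apply lam h a b _ _).trans ?_
  refine Eq.trans ?_ (warpComb_apply _ _ _ v w).symm
  have e1 := inTangentCoordinates_mfderiv (I := I) h x b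
  have e2 := inTangentCoordinates_mfderiv (I := I) a x b
  rw [← e1 v, ← e1 w, ← e2 v, ← e2 w]

theorem contMDiff_warpedForm [IsManifold I ∞ M] (lam : ℝ) {h : M → ℝ} {a : M → F}
    (hh : ContMDiff I 𝓘(ℝ, ℝ) ∞ h) (ha : ContMDiff I 𝓘(ℝ, F) ∞ a) :
    ContMDiff I (I.prod 𝓘(ℝ, E →L[ℝ] E →L[ℝ] ℝ)) ∞
      (fun p ↦ TotalSpace.mk' (E := fun p : M => TangentSpace I p →L[ℝ] TangentSpace I p →L[ℝ] ℝ)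
       (E →L[ℝ] E →L[ℝ] ℝ) p (warpedForm I lam h a p)) := by
  intro x
  rw [contMDiffAt_section]
  have h1 := (hh x).mfderiv_const (m := ∞) (by simp)
  have h2 := (ha x).mfderiv_const (m := ∞) (by simp)
  have h3 : ContMDiffAt I 𝓘(ℝ, ℝ) ∞ (fun p => Real.exp (-(2 * lam * h p))) x :=
    (show ContDiff ℝ ∞ (fun t => Real.exp (-(2 * lam * t))) by fun_prop).contMDiff.contMDiffAt.comp
      x (hh x)
  have h4 := contDiff_warpComb.contMDiff.contMDiffAt.comp x
    (h3.prodMk_space (h1.prodMk_space h2))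
  refine h4.congr_of_eventuallyEq ?_
  have hb := (trivializationAt E (TangentSpace I) x).open_baseSet.mem_nhds
    (FiberBundle.mem_baseSet_trivializationAt' x)
  filter_upwards [hb] with b hb
  ext v w
  simp only [hom_trivializationAt_apply, ContinuousLinearMap.inCoordinates, Function.comp_apply]
  have q := (continuousLinearMapAt_hom_apply hb (warpedForm I lam h a b
    (Trivialization.symmL ℝ (trivializationAt E (TangentSpace I) x) b v)) w).trans
      (warpedForm_symmL lam h a x b v w)
  exact q

theorem isVonNBounded_of_pos [FiniteDimensional ℝ E] (B : E →L[ℝ] E →L[ℝ] ℝ)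
    (hB : ∀ v, v ≠ 0 → 0 < B v v) : IsVonNBounded ℝ {v : E | B v v < 1} := by
  have hc : Continuous fun v => B v v := by fun_prop
  obtain ⟨c, hc0, hcB⟩ : ∃ c > 0, ∀ v : E, ‖v‖ = 1 → c ≤ B v v := by
    rcases (Metric.sphere (0 : E) 1).eq_empty_or_nonempty with he | hne
    · exact ⟨1, one_pos, fun v hv => by
        have : v ∈ Metric.sphere (0 : E) 1 := by simpa using hv
        rw [he] at this; exact this.elim⟩
    · have : ProperSpace E := FiniteDimensional.proper ℝ E
      obtain ⟨u, hu, hmin⟩ := (isCompact_sphere (0 : E) 1).exists_isMinOn hne hc.continuousOn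
      refine ⟨B u u, hB u ?_, fun v hv => hmin (by simpa using hv)⟩
      rintro rfl; simp at hu
  rw [NormedSpace.isVonNBounded_iff]
  refine (Metric.isBounded_closedBall (x := (0:E)) (r := √(1 / c))).subset fun v hv => ?_
  simp only [mem_closedBall_zero_iff, mem_ofPred_eq] at hv ⊢
  apply Real.le_sqrt_of_sq_le
  rw [le_div_iff₀ hc0]
  rcases eq_or_ne v 0 with rfl | h0
  · simp
  have hn : 0 < ‖v‖ := norm_pos_iff.2 h0
  have := hcB (‖v‖⁻¹ • v) (by simp [norm_smul, hn.ne'])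
  simp at this
  have h2 : B v v = ‖v‖ * (‖v‖ * (‖v‖⁻¹ * (‖v‖⁻¹ * B v v))) := by field_simp
  nlinarith [mul_le_mul_of_nonneg_left this (mul_nonneg hn.le hn.le)]

end Forms

/-! The warped product model spaces. -/

instance instT3SpaceHalfSpace : T3Space (EuclideanHalfSpace 1) :=
  inferInstanceAs (T3Space {x : EuclideanSpace ℝ (Fin 1) // 0 ≤ x 0})


/-- The closed half-line `[0, ∞)` times the unit sphere `𝕊^{n-1}` of `ℝ ^ n`, a manifold with
boundary of dimension `n ≥ 1`. The index `n - 1 + 1` is `n`; it is written in this form because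
Mathlib's charts of the unit sphere are indexed by the dimension `n - 1` of the sphere. -/
abbrev HalfCylinder (n : ℕ) : Type :=
  EuclideanHalfSpace 1 × Metric.sphere (0 : EuclideanSpace ℝ (Fin (n - 1 + 1))) 1

namespace HalfCylinder

/-- The vector space on which the manifold `[0, ∞) × 𝕊^{n-1}` is modelled. -/
abbrev Coord (n : ℕ) : Type := EuclideanSpace ℝ (Fin 1) × EuclideanSpace ℝ (Fin (n - 1))

/-- The local model of the manifold with boundary `[0, ∞) × 𝕊^{n-1}`. -/
abbrev Chart (n : ℕ) : Type := ModelProd (EuclideanHalfSpace 1) (EuclideanSpace ℝ (Fin (n - 1)))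

/-- The model with corners of `[0, ∞) × 𝕊^{n-1}`. -/
abbrev model (n : ℕ) : ModelWithCorners ℝ (Coord n) (Chart n) :=
  ModelWithCorners.prod (modelWithCornersEuclideanHalfSpace 1) (𝓡 (n - 1))

variable {n : ℕ}

/-- The coordinate `t` of the point `(t, θ)`. -/
def height (p : HalfCylinder n) : ℝ := p.1.1 0

/-- The coordinate `θ` of the point `(t, θ)`, as a unit vector of `ℝ ^ n`. -/
def angle (p : HalfCylinder n) : EuclideanSpace ℝ (Fin (n - 1 + 1)) := p.2

theorem hasMFDerivAt_height (p : HalfCylinder n) :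
    HasMFDerivAt (model n) 𝓘(ℝ, ℝ) height p
      ((EuclideanSpace.proj (0 : Fin 1) : EuclideanSpace ℝ (Fin 1) →L[ℝ] ℝ).comp
        (ContinuousLinearMap.fst ℝ _ _)) := by
  have h0 : HasMFDerivAt (model n) (modelWithCornersEuclideanHalfSpace 1) Prod.fst p _ := hasMFDerivAt_fst p
  have h1 := ((modelWithCornersEuclideanHalfSpace 1).hasMFDerivAt (x := p.1)).comp p h0
  exact (EuclideanSpace.proj (0 : Fin 1) : EuclideanSpace ℝ (Fin 1) →L[ℝ] ℝ).hasMFDerivAt.comp p h1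

theorem contMDiff_height : ContMDiff (model n) 𝓘(ℝ, ℝ) ∞ (height : HalfCylinder n → ℝ) := by
  have h1 : ContMDiff (model n) 𝓘(ℝ, EuclideanSpace ℝ (Fin 1)) ∞ (fun p : HalfCylinder n => modelWithCornersEuclideanHalfSpace 1 p.1) :=
    ((modelWithCornersEuclideanHalfSpace 1).contMDiff).comp contMDiff_fst
  exact (EuclideanSpace.proj (0 : Fin 1) : EuclideanSpace ℝ (Fin 1) →L[ℝ] ℝ).contDiff.contMDiff.comp h1

theorem contMDiff_angle : ContMDiff (model n) 𝓘(ℝ, EuclideanSpace ℝ (Fin (n - 1 + 1))) ∞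
    (angle : HalfCylinder n → _) :=
  have := Fact.mk (@finrank_euclideanSpace_fin ℝ _ (n - 1 + 1))
  (contMDiff_coe_sphere (n := n - 1)).comp contMDiff_snd

theorem mvfderiv_height (p : HalfCylinder n) (v : TangentSpace (model n) p) :
    mvfderiv (model n) height p v = v.1 0 := by
  have := (hasMFDerivAt_height p).mfderiv
  simp only [mvfderiv, this]
  rfl

theorem mvfderiv_angle (p : HalfCylinder n) (v : TangentSpace (model n) p) :
    mvfderiv (model n) angle p v =
      mvfderiv (𝓡 (n - 1))
        (Subtype.val : Metric.sphere (0 : EuclideanSpace ℝ (Fin (n - 1 + 1))) 1 → _) p.2 v.2 := by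
  have := Fact.mk (@finrank_euclideanSpace_fin ℝ _ (n - 1 + 1))
  have h0 : HasMFDerivAt (model n) (𝓡 (n - 1)) Prod.snd p _ := hasMFDerivAt_snd p
  have h1 := ((contMDiff_coe_sphere (m := 1) (n := n - 1)).mdifferentiable one_ne_zero
    p.2).hasMFDerivAt
  have h2 : mfderiv (model n) 𝓘(ℝ, EuclideanSpace ℝ (Fin (n - 1 + 1))) angle p = _ :=
    (h1.comp p h0).mfderiv
  simp only [mvfderiv, h2]
  rfl

theorem warpedForm_pos (lam : ℝ) (p : HalfCylinder n) (v : TangentSpace (model n) p) (hv : v ≠ 0) :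
    0 < warpedForm (model n) lam height angle p v v := by
  have := Fact.mk (@finrank_euclideanSpace_fin ℝ _ (n - 1 + 1))
  rw [warpedForm_apply, mvfderiv_height, mvfderiv_angle]
  by_contra! hle
  rw [real_inner_self_eq_norm_sq] at hle
  have he := Real.exp_pos (-(2 * lam * height p))
  set w := mvfderiv (𝓡 (n - 1))
    (Subtype.val : Metric.sphere (0 : EuclideanSpace ℝ (Fin (n - 1 + 1))) 1 → _) p.2 v.2 with hw
  have h1 : v.1 0 = 0 := by nlinarith [mul_nonneg he.le (sq_nonneg ‖w‖)]
  have h2 : ‖w‖ ^ 2 = 0 := by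
    rw [h1] at hle
    have := mul_nonneg he.le (sq_nonneg ‖w‖)
    have h : Real.exp (-(2 * lam * height p)) * ‖w‖ ^ 2 = 0 := by linarith
    exact (mul_eq_zero.1 h).resolve_left he.ne'
  have h3 : w = 0 := by simpa using h2
  apply hv
  have h4 : v.2 = 0 := injective_mvfderiv_subtypeVal_sphere (n := n - 1) p.2 (by
    rw [← hw, h3]; exact (map_zero _).symm)
  have h5 : v.1 = 0 := by
    ext i; rw [Subsingleton.elim i 0]; exact h1
  exact Prod.ext h5 h4

/-- The warped product metric `dt² + e^{-2 lam t} ds²` on `[0, ∞) × 𝕊^{n-1}`, where `ds²` is the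
metric of the unit sphere, i.e. the restriction of the inner product of `ℝ ^ n`. -/
def warpedMetric (n : ℕ) (lam : ℝ) : ContMDiffRiemannianMetric (model n) ∞ (Coord n)
    (fun p : HalfCylinder n => TangentSpace (model n) p) where
  inner p := warpedForm (model n) lam height angle p
  symm p v w := by rw [warpedForm_apply, warpedForm_apply, mul_comm, real_inner_comm]
  pos p v hv := warpedForm_pos lam p v hv
  isVonNBounded p := isVonNBounded_of_pos (E := Coord n)
    (warpedForm (model n) lam height angle p) (warpedForm_pos lam p)
  contMDiff := contMDiff_warpedForm lam contMDiff_height contMDiff_angle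

end HalfCylinder

/-- The warped product model space `M^n_{κ, lam}`, i.e. `[0, ∞) × 𝕊^{n-1}` with the metric
`dt² + e^{-2 lam t} ds²`. It is used with `κ < 0` and `lam = √|κ|`, so that the number `κ` enters
only through `lam`. -/
def WarpedModel (n : ℕ) (_κ _lam : ℝ) : Type := HalfCylinder n

namespace WarpedModel

open HalfCylinder

variable {n : ℕ} {κ lam : ℝ}

instance : TopologicalSpace (WarpedModel n κ lam) :=
  inferInstanceAs (TopologicalSpace (HalfCylinder n))

instance : T3Space (WarpedModel n κ lam) := inferInstanceAs (T3Space (HalfCylinder n))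

instance : ChartedSpace (Chart n) (WarpedModel n κ lam) :=
  inferInstanceAs (ChartedSpace (Chart n) (HalfCylinder n))

instance : IsManifold (model n) ∞ (WarpedModel n κ lam) :=
  inferInstanceAs (IsManifold (model n) ∞ (HalfCylinder n))

instance : RiemannianBundle (fun p : WarpedModel n κ lam ↦ TangentSpace (model n) p) :=
  ⟨(warpedMetric n lam).toRiemannianMetric⟩

instance : IsContMDiffRiemannianBundle (model n) ∞ (Coord n)
    (fun p : WarpedModel n κ lam ↦ TangentSpace (model n) p) :=
  ⟨(warpedMetric n lam).inner, (warpedMetric n lam).contMDiff, fun _ _ _ ↦ rfl⟩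

instance : IsContinuousRiemannianBundle (Coord n)
    (fun p : WarpedModel n κ lam ↦ TangentSpace (model n) p) :=
  ⟨(warpedMetric n lam).inner, (warpedMetric n lam).contMDiff.continuous, fun _ _ _ ↦ rfl⟩

/-- The Riemannian distance. -/
instance : EMetricSpace (WarpedModel n κ lam) := EMetricSpace.ofRiemannianMetric (model n) _

instance : IsRiemannianManifold (model n) (WarpedModel n κ lam) := ⟨fun _ _ ↦ rfl⟩

instance : MeasurableSpace (WarpedModel n κ lam) := borel _

instance : BorelSpace (WarpedModel n κ lam) := ⟨rfl⟩

variable (n κ lam)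

/-- The boundary of the manifold `M^n_{κ, lam}`. -/
def bdry : Set (WarpedModel n κ lam) := (model n).boundary (WarpedModel n κ lam)

/-- The point `(t, θ)` of `M^n_{κ, lam}`. -/
def mkPoint (q : ℝ≥0 × Metric.sphere (0 : EuclideanSpace ℝ (Fin (n - 1 + 1))) 1) :
    WarpedModel n κ lam :=
  (⟨WithLp.toLp 2 fun _ ↦ (q.1 : ℝ), q.1.2⟩, q.2)

/-- The Riemannian volume measure of `M^n_{κ, lam}`: in the coordinates `(t, θ)`, the volume element
of `dt² + e^{-2 lam t} ds²` is `e^{-(n-1) lam t}` times the product of `dt` with the surface measure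
of the unit sphere `𝕊^{n-1}`. -/
def vol : Measure (WarpedModel n κ lam) :=
  ((halfLineVolume.prod (volume : Measure (EuclideanSpace ℝ (Fin (n - 1 + 1)))).toSphere).withDensity
    fun q ↦ ENNReal.ofReal (Real.exp (-(lam * (q.1 : ℝ))) ^ (n - 1))).map (mkPoint n κ lam)

/-- The normalized volume measure of `M^n_{κ, lam}`. -/
def normVol : Measure (WarpedModel n κ lam) := (vol n κ lam univ)⁻¹ • vol n κ lam

end WarpedModel

end BoundaryConcentration

end

/-!
On the warped product `[0, ∞) × 𝕊^{n-1}` with metric `dt² + e^{-2 lam t} ds²`, the coordinate `t` is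
the distance to the boundary `{t = 0}`: it is `1`-Lipschitz because `|dt(v)| ≤ |v|` for every tangent
vector `v` (`WarpedModel.lipschitzWith_toHeight`), and the vertical segment from `(0, θ)` to `(t, θ)`
has length at most `t` (`WarpedModel.edist_mkPoint_zero_le`). A `1`-Lipschitz function
`φ ≥ 0` that vanishes on the boundary is therefore at most `t`, and the partial inscribed radius of
the screen is monotone in `φ` (`partInRad_map_mono`). Hence the supremum that defines the observable
inscribed radius is attained at `φ = t` (`obsInRad_eq_partInRad_map`).

The image of the normalized volume under `t` is the exponential distribution with rate
`Λ = (n - 1) lam` (`WarpedModel.map_toHeight_normVol`). Among the Borel subsets of `[0, ∞)` of given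
inscribed radius `s` the interval `[0, s]` is the largest, so `PartInRad(E_Λ; 1 - η)` is the number
`r` with `1 - e^{-Λ r} = 1 - η`, namely `log (1 / η) / Λ` (`partInRad_expMeasure`). This gives the
explicit value of the observable inscribed radius (`WarpedModel.obsInRad_eq`), from which both parts
of the theorem are read off.
-/

noncomputable section

namespace BoundaryConcentration

/-! ### Inscribed radii of subsets of the half-line, and of screens -/

theorem infEDist_singleton_zero (x : ℝ≥0) : Metric.infEDist x {(0 : ℝ≥0)} = x := by
  rw [Metric.infEDist_singleton, edist_nndist, NNReal.nndist_zero_eq_val']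

theorem subset_Iic_of_inRad_le {Ω : Set ℝ≥0} {s : ℝ≥0} (h : inRad {(0 : ℝ≥0)} Ω ≤ s) :
    Ω ⊆ Iic s := fun x hx ↦ by
  have := (le_iSup₂ (f := fun x (_ : x ∈ Ω) ↦ Metric.infEDist x {(0 : ℝ≥0)}) x hx).trans h
  rw [infEDist_singleton_zero] at this
  exact_mod_cast this

theorem partInRad_le_of_le_measure_Iic {μ : Measure ℝ≥0} {ξ : ℝ} {r : ℝ≥0}
    (h : ENNReal.ofReal ξ ≤ μ (Iic r)) : partInRad {(0 : ℝ≥0)} μ ξ ≤ r := by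
  refine (iInf₂_le _ measurableSet_Iic).trans ((iInf_le _ h).trans (iSup₂_le fun x hx ↦ ?_))
  rw [infEDist_singleton_zero]
  exact_mod_cast hx

theorem le_partInRad_of_measure_Iic_lt {μ : Measure ℝ≥0} {ξ : ℝ} {r : ℝ≥0}
    (h : ∀ s < r, μ (Iic s) < ENNReal.ofReal ξ) : (r : ℝ≥0∞) ≤ partInRad {(0 : ℝ≥0)} μ ξ := by
  refine le_iInf₂ fun Ω _ ↦ le_iInf fun hΩ ↦ ?_
  by_contra! hlt
  lift inRad {(0 : ℝ≥0)} Ω to ℝ≥0 using hlt.ne_top with s hs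
  exact (hΩ.trans (measure_mono (subset_Iic_of_inRad_le hs.ge))).not_gt (h s (mod_cast hlt))

/-- Larger screens have larger partial inscribed radii: among the sets of given inscribed radius
`s`, the interval `[0, s]` is the largest, and it has the larger preimage under the smaller
function. -/
theorem partInRad_map_mono {X : Type*} [MeasurableSpace X] {μ : Measure X} {φ ψ : X → ℝ≥0}
    (hφ : Measurable φ) (hψ : Measurable ψ) (hle : φ ≤ ψ) (ξ : ℝ) :
    partInRad {(0 : ℝ≥0)} (μ.map φ) ξ ≤ partInRad {(0 : ℝ≥0)} (μ.map ψ) ξ := by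
  refine le_iInf₂ fun Ω hΩm ↦ le_iInf fun hΩ ↦ ?_
  rcases eq_or_ne (inRad {(0 : ℝ≥0)} Ω) ∞ with htop | htop
  · exact htop ▸ le_top
  lift inRad {(0 : ℝ≥0)} Ω to ℝ≥0 using htop with s hs
  refine partInRad_le_of_le_measure_Iic (hΩ.trans ?_)
  rw [Measure.map_apply hψ hΩm, Measure.map_apply hφ measurableSet_Iic]
  exact measure_mono fun x hx ↦ (hle x).trans (subset_Iic_of_inRad_le hs.ge hx)

/-- If the distance to the boundary is realized by a `1`-Lipschitz function `T`, then `T` is the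
largest competitor in the definition of the observable inscribed radius. -/
theorem obsInRad_eq_partInRad_map {X : Type*} [PseudoEMetricSpace X] [MeasurableSpace X]
    [OpensMeasurableSpace X] {bd : Set X} {T : X → ℝ≥0} (hT : LipschitzWith 1 T)
    (hbd : ∀ x ∈ bd, T x = 0) (hdist : ∀ x, ∃ y ∈ bd, edist x y ≤ T x) (μ : Measure X) (η : ℝ) :
    obsInRad bd μ η = partInRad {(0 : ℝ≥0)} (μ.map T) (1 - η) := by
  refine le_antisymm (iSup₂_le fun φ hφ ↦ iSup_le fun hφ0 ↦ ?_) ?_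
  · refine partInRad_map_mono hφ.continuous.measurable hT.continuous.measurable (fun x ↦ ?_) _
    obtain ⟨y, hy, hxy⟩ := hdist x
    have := (hφ x y).trans (by simpa using hxy)
    rw [hφ0 y hy, ← Metric.infEDist_singleton, infEDist_singleton_zero] at this
    exact_mod_cast this
  · exact le_iSup_of_le T (le_iSup₂_of_le hT hbd le_rfl)

/-! ### The exponential model space -/

theorem measurableEmbedding_coe_nnreal : MeasurableEmbedding ((↑) : ℝ≥0 → ℝ) :=
  MeasurableEmbedding.subtype_coe (measurableSet_Ici (a := (0 : ℝ)))

theorem map_coe_halfLineVolume :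
    halfLineVolume.map ((↑) : ℝ≥0 → ℝ) = volume.restrict (Ici 0) := by
  rw [halfLineVolume, measurableEmbedding_coe_nnreal.map_comap, NNReal.range_coe]

/-- Under the inclusion of `[0, ∞)` into `ℝ`, the measure of `E_Λ` is the exponential
distribution with rate `Λ`. -/
theorem map_coe_expMeasure (Λ : ℝ) :
    (expMeasure Λ).map ((↑) : ℝ≥0 → ℝ) = ProbabilityTheory.expMeasure Λ := by
  ext s hs
  have hpdf : ProbabilityTheory.gammaPDF 1 Λ =
      (Ici 0).indicator fun t ↦ ENNReal.ofReal (Λ * Real.exp (-(Λ * t))) := by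
    ext t
    refine (ProbabilityTheory.exponentialPDF_eq Λ t).trans ?_
    simp only [indicator_apply, mem_Ici]
    split_ifs <;> simp
  rw [Measure.map_apply measurableEmbedding_coe_nnreal.measurable hs, expMeasure,
    withDensity_apply _ (measurableEmbedding_coe_nnreal.measurable hs),
    ← measurableEmbedding_coe_nnreal.lintegral_map
      (fun t ↦ ENNReal.ofReal (Λ * Real.exp (-(Λ * t)))),
    ← measurableEmbedding_coe_nnreal.restrict_map, map_coe_halfLineVolume,
    ← withDensity_apply _ hs, ProbabilityTheory.expMeasure, ProbabilityTheory.gammaMeasure, hpdf,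
    withDensity_indicator measurableSet_Ici]

theorem expMeasure_Iic {Λ : ℝ} (hΛ : 0 < Λ) (s : ℝ≥0) :
    expMeasure Λ (Iic s) = ENNReal.ofReal (1 - Real.exp (-(Λ * s))) := by
  have := ProbabilityTheory.isProbabilityMeasure_expMeasure hΛ
  have h := ProbabilityTheory.ofReal_cdf (ProbabilityTheory.expMeasure Λ) s
  rw [ProbabilityTheory.cdf_expMeasure_eq hΛ, if_pos s.coe_nonneg, ← map_coe_expMeasure,
    Measure.map_apply measurableEmbedding_coe_nnreal.measurable measurableSet_Iic] at h
  exact h.symm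

theorem expMeasure_univ {Λ : ℝ} (hΛ : 0 < Λ) : expMeasure Λ univ = 1 := by
  have := ProbabilityTheory.isProbabilityMeasure_expMeasure hΛ
  have h := measure_univ (μ := ProbabilityTheory.expMeasure Λ)
  rwa [← map_coe_expMeasure,
    Measure.map_apply measurableEmbedding_coe_nnreal.measurable MeasurableSet.univ] at h

/-- `PartInRad(E_Λ; 1 - η)` is the radius `r` for which `[0, r]` has measure exactly `1 - η`. -/
theorem partInRad_expMeasure {Λ η : ℝ} (hΛ : 0 < Λ) (hη : 0 < η) (hη1 : η ≤ 1) :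
    partInRad {(0 : ℝ≥0)} (expMeasure Λ) (1 - η) = ENNReal.ofReal (Real.log (1 / η) / Λ) := by
  have hlog : 0 ≤ Real.log (1 / η) := Real.log_nonneg ((one_le_div hη).2 hη1)
  have hmul : Λ * (Real.log (1 / η) / Λ) = -Real.log η := by
    rw [mul_div_cancel₀ _ hΛ.ne', one_div, Real.log_inv]
  refine le_antisymm (partInRad_le_of_le_measure_Iic ?_)
    (le_partInRad_of_measure_Iic_lt fun s hs ↦ ?_)
  · rw [expMeasure_Iic hΛ, Real.coe_toNNReal _ (by positivity), hmul, neg_neg, Real.exp_log hη]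
  · rw [Real.lt_toNNReal_iff_coe_lt, lt_div_iff₀ hΛ, one_div, Real.log_inv] at hs
    have : η < Real.exp (-(Λ * s)) := by
      rw [← Real.log_lt_iff_lt_exp hη]; linarith
    rw [expMeasure_Iic hΛ]
    refine (ENNReal.ofReal_lt_ofReal_iff ?_).2 (by linarith)
    have h1 : Real.exp (-(Λ * s)) ≤ 1 := Real.exp_le_one_iff.2 (by
      have := mul_nonneg hΛ.le s.2; simpa using this)
    linarith

theorem sub_one_mul_pos {n : ℕ} {lam : ℝ} (hn : 2 ≤ n) (hlam : 0 < lam) :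
    0 < ((n : ℝ) - 1) * lam := by
  have : (2 : ℝ) ≤ n := mod_cast hn
  exact mul_pos (by linarith) hlam

/-! ### The distance to the boundary in the warped product -/

/-- The chain rule for a vector-valued function along a path in a manifold. -/
theorem mvfderiv_mfderivWithin_path {E H M F : Type*} [NormedAddCommGroup E] [NormedSpace ℝ E]
    [TopologicalSpace H] {I : ModelWithCorners ℝ E H} [TopologicalSpace M] [ChartedSpace H M]
    [NormedAddCommGroup F] [NormedSpace ℝ F] {f : M → F} {γ : ℝ → M} {a b t : ℝ}
    (hf : MDifferentiableAt I 𝓘(ℝ, F) f (γ t)) (hab : a < b) (ht : t ∈ Icc a b)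
    (hγ : MDifferentiableWithinAt 𝓘(ℝ, ℝ) I γ (Icc a b) t) :
    mvfderiv I f (γ t) (mfderivWithin 𝓘(ℝ, ℝ) I γ (Icc a b) t (1 : ℝ)) =
      derivWithin (f ∘ γ) (Icc a b) t := by
  have hu : UniqueMDiffWithinAt 𝓘(ℝ, ℝ) (Icc a b) t :=
    uniqueMDiffWithinAt_iff_uniqueDiffWithinAt.2 (uniqueDiffOn_Icc hab t ht)
  have h := mfderiv_comp_mfderivWithin t hf hγ hu
  rw [← fderivWithin_derivWithin, ← mfderivWithin_eq_fderivWithin, h]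
  rfl

namespace WarpedModel

open HalfCylinder

variable {n : ℕ} {κ lam : ℝ}

/-- The coordinate `t` of the point `(t, θ)`, as a function with values in `[0, ∞)`. -/
def toHeight (p : WarpedModel n κ lam) : ℝ≥0 := ⟨HalfCylinder.height (n := n) p, p.1.2⟩

/-- The coordinate `t` of the point `(t, θ)`, as a real function. -/
def realHeight (p : WarpedModel n κ lam) : ℝ := HalfCylinder.height (n := n) p

/-- The coordinate `θ` of the point `(t, θ)`, as a unit vector of `ℝ ^ n`. -/
def direction (p : WarpedModel n κ lam) : EuclideanSpace ℝ (Fin (n - 1 + 1)) :=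
  HalfCylinder.angle (n := n) p

theorem contMDiff_realHeight :
    ContMDiff (model n) 𝓘(ℝ, ℝ) ∞ (realHeight : WarpedModel n κ lam → ℝ) :=
  contMDiff_height (n := n)

theorem contMDiff_direction :
    ContMDiff (model n) 𝓘(ℝ, EuclideanSpace ℝ (Fin (n - 1 + 1))) ∞
      (direction : WarpedModel n κ lam → _) :=
  contMDiff_angle (n := n)

theorem mkPoint_surjective : Function.Surjective (mkPoint n κ lam) := fun p ↦ by
  refine ⟨(toHeight p, p.2), Prod.ext (Subtype.ext ?_) rfl⟩
  ext i
  rw [Subsingleton.elim i 0]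
  rfl

theorem mem_bdry_iff {p : WarpedModel n κ lam} : p ∈ bdry n κ lam ↔ toHeight p = 0 := by
  have := Fact.mk (@finrank_euclideanSpace_fin ℝ _ (n - 1 + 1))
  have h : bdry n κ lam = Set.prod ((𝓡∂ 1).boundary (EuclideanHalfSpace 1)) univ :=
    ModelWithCorners.boundary_of_boundaryless_right (I := 𝓡∂ 1) (J := 𝓡 (n - 1))
      (M := EuclideanHalfSpace 1)
      (N := Metric.sphere (0 : EuclideanSpace ℝ (Fin (n - 1 + 1))) 1)
  rw [h]
  change p.1 ∈ (𝓡∂ 1).boundary (EuclideanHalfSpace 1) ∧ _ ↔ _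
  have h2 : p.1 ∈ (𝓡∂ 1).boundary (EuclideanHalfSpace 1) ↔ 0 = p.1.1 0 := by
    change extChartAt (𝓡∂ 1) p.1 p.1 ∈ frontier (range (𝓡∂ 1)) ↔ _
    rw [frontier_range_modelWithCornersEuclideanHalfSpace]
    rfl
  rw [h2, ← NNReal.coe_eq_zero]
  exact ⟨fun h ↦ h.1.symm, fun h ↦ ⟨h.symm, mem_univ _⟩⟩

/-- The Riemannian norm of a tangent vector is the one of `dt² + e^{-2 lam t} ds²`. -/
theorem norm_sq_tangent (p : WarpedModel n κ lam) (v : TangentSpace (model n) p) :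
    ‖v‖ ^ 2 = mvfderiv (model n) realHeight p v ^ 2 +
      Real.exp (-(2 * lam * realHeight p)) * ‖mvfderiv (model n) direction p v‖ ^ 2 := by
  rw [← real_inner_self_eq_norm_sq v, ← real_inner_self_eq_norm_sq (mvfderiv _ _ _ _), sq]
  have h (q : HalfCylinder n) (w : TangentSpace (model n) q) :=
    warpedForm_apply (I := model n) lam height angle q w w
  exact h p v

theorem enorm_mvfderiv_realHeight_le (p : WarpedModel n κ lam) (v : TangentSpace (model n) p) :
    ‖mvfderiv (model n) realHeight p v‖ₑ ≤ ‖v‖ₑ := by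
  rw [← ofReal_norm, ← ofReal_norm]
  refine ENNReal.ofReal_le_ofReal (le_of_sq_le_sq ?_ (norm_nonneg v))
  rw [norm_sq_tangent, Real.norm_eq_abs, sq_abs]
  exact le_add_of_nonneg_right (by positivity)

/-- The coordinate `t` is `1`-Lipschitz for the Riemannian distance: its increment along a path is
at most the length of the path. -/
theorem lipschitzWith_toHeight :
    LipschitzWith 1 (toHeight : WarpedModel n κ lam → ℝ≥0) := by
  intro x y
  rw [ENNReal.coe_one, one_mul, IsRiemannianManifold.out (I := model n) x y]
  refine le_of_forall_gt fun r hr ↦ ?_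
  obtain ⟨γ, rfl, rfl, hγ, hlen⟩ := exists_lt_of_riemannianEDist_lt hr
  refine lt_of_le_of_lt ?_ hlen
  have hC : ContDiffOn ℝ 1 (realHeight ∘ γ) (Icc 0 1) :=
    contMDiffOn_iff_contDiffOn.1 ((contMDiff_realHeight.of_le (by simp)).comp_contMDiffOn hγ)
  rw [pathELength_eq_lintegral_mfderivWithin_Icc, edist_comm]
  refine le_trans (le_of_eq (edist_eq_enorm_sub (realHeight (γ 1)) (realHeight (γ 0))))
    ((enorm_sub_le_lintegral_derivWithin_Icc_of_contDiffOn_Icc hC zero_le_one).trans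
      (setLIntegral_mono' measurableSet_Icc fun t ht ↦ ?_))
  rw [← mvfderiv_mfderivWithin_path
    (contMDiff_realHeight.mdifferentiable (by simp) (γ t)) zero_lt_one ht
    (hγ.mdifferentiableOn one_ne_zero t ht)]
  exact enorm_mvfderiv_realHeight_le _ _

/-- The vertical segment from `(0, θ)` to `(t, θ)` has length at most `t`. -/
theorem edist_mkPoint_zero_le (t : ℝ≥0)
    (θ : Metric.sphere (0 : EuclideanSpace ℝ (Fin (n - 1 + 1))) 1) :
    edist (mkPoint n κ lam (t, θ)) (mkPoint n κ lam (0, θ)) ≤ t := by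
  rcases eq_or_ne t 0 with rfl | ht0
  · simp
  have ht0 : (0 : ℝ) < t := by positivity
  -- The inverse chart of the half-line is smooth on its range, which contains the segment `[0, t]`.
  let γ : ℝ → WarpedModel n κ lam := fun s ↦ ((𝓡∂ 1).symm (WithLp.toLp 2 fun _ ↦ s), θ)
  have hγC : ContMDiffOn 𝓘(ℝ, ℝ) (model n) 1 γ (Icc 0 t) := by
    refine ContMDiffOn.prodMk ?_ contMDiffOn_const
    refine ((𝓡∂ 1).contMDiffOn_symm).comp (t := range (𝓡∂ 1)) ?_ ?_
    · refine ContMDiff.contMDiffOn (contMDiff_iff_contDiff.2 ?_)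
      fun_prop
    · intro s hs
      rw [range_modelWithCornersEuclideanHalfSpace]
      exact hs.1
  have hγ : ∀ s : ℝ≥0, γ s = mkPoint n κ lam (s, θ) := by
    intro s
    refine Prod.ext (Subtype.ext ?_) rfl
    ext i
    rw [Subsingleton.elim i 0]
    simp [γ, mkPoint, modelWithCornersEuclideanHalfSpace_symm_apply]
  rw [edist_comm, IsRiemannianManifold.out (I := model n)]
  refine (riemannianEDist_le_pathELength hγC (hγ 0) (hγ t) t.2).trans ?_
  rw [pathELength_eq_lintegral_mfderivWithin_Icc]
  have hone : ∀ s ∈ Icc (0 : ℝ) t,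
      ‖mfderivWithin 𝓘(ℝ, ℝ) (model n) γ (Icc 0 t) s (1 : ℝ)‖ₑ ≤ 1 := fun s hs ↦ by
    have hγd := hγC.mdifferentiableOn one_ne_zero s hs
    have hu : EqOn (realHeight ∘ γ) id (Icc 0 t) := fun u hu ↦
      congrArg realHeight (hγ ⟨u, hu.1⟩)
    -- Along `γ` the coordinate `t` has derivative `1` and `θ` has derivative `0`.
    rw [← ofReal_norm, ENNReal.ofReal_le_one, ← sq_le_one_iff₀ (norm_nonneg _), norm_sq_tangent,
      mvfderiv_mfderivWithin_path (contMDiff_realHeight.mdifferentiable (by simp) _) ht0 hs hγd,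
      mvfderiv_mfderivWithin_path (contMDiff_direction.mdifferentiable (by simp) _) ht0 hs hγd,
      derivWithin_congr hu (hu hs), derivWithin_id _ _ (uniqueDiffOn_Icc ht0 s hs),
      show direction ∘ γ = fun _ ↦ (θ : EuclideanSpace ℝ (Fin (n - 1 + 1))) from rfl]
    simp
  refine (setLIntegral_mono' measurableSet_Icc hone).trans ?_
  simp

theorem exists_bdry_edist_le_toHeight (p : WarpedModel n κ lam) :
    ∃ y ∈ bdry n κ lam, edist p y ≤ toHeight p := by
  obtain ⟨⟨t, θ⟩, rfl⟩ := mkPoint_surjective p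
  exact ⟨mkPoint n κ lam (0, θ), mem_bdry_iff.2 rfl, edist_mkPoint_zero_le t θ⟩

/-! ### The distribution of the distance to the boundary -/

theorem continuous_mkPoint : Continuous (mkPoint n κ lam) := by
  refine Continuous.prodMk (Continuous.subtype_mk ?_ _) continuous_snd
  fun_prop

theorem measurable_toHeight : Measurable (toHeight : WarpedModel n κ lam → ℝ≥0) :=
  lipschitzWith_toHeight.continuous.measurable

/-- In the coordinates `(t, θ)` the volume is a product measure, so its image under `t` is
proportional to `e^{-(n-1) lam t} dt`. -/
theorem map_toHeight_vol (hn : 2 ≤ n) (hlam : 0 < lam) :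
    (vol n κ lam).map toHeight =
      ((volume : Measure (EuclideanSpace ℝ (Fin (n - 1 + 1)))).toSphere univ /
        ENNReal.ofReal ((n - 1) * lam)) • expMeasure ((n - 1) * lam) := by
  have hΛ : 0 < ((n : ℝ) - 1) * lam :=
    sub_one_mul_pos hn hlam
  set Λ := ((n : ℝ) - 1) * lam
  have hexp : ∀ t : ℝ≥0, ENNReal.ofReal (Real.exp (-(lam * (t : ℝ))) ^ (n - 1)) =
      (ENNReal.ofReal Λ)⁻¹ * ENNReal.ofReal (Λ * Real.exp (-(Λ * (t : ℝ)))) := fun t ↦ by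
    rw [ENNReal.ofReal_mul hΛ.le, ← mul_assoc, ENNReal.inv_mul_cancel (by simpa using hΛ)
      ENNReal.ofReal_ne_top, one_mul, ← Real.exp_nat_mul, Nat.cast_sub (by omega), Nat.cast_one,
      mul_neg, ← mul_assoc]
  have hmeas : Measurable fun t : ℝ≥0 ↦ ENNReal.ofReal (Λ * Real.exp (-(Λ * (t : ℝ)))) := by
    fun_prop
  ext s hs
  have hfst : (fun q : ℝ≥0 × Metric.sphere (0 : EuclideanSpace ℝ (Fin (n - 1 + 1))) 1 ↦ q.1) ⁻¹' s =
      (toHeight ∘ mkPoint n κ lam) ⁻¹' s := rfl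
  rw [vol, Measure.map_map measurable_toHeight continuous_mkPoint.measurable,
    Measure.map_apply (measurable_toHeight.comp continuous_mkPoint.measurable) hs, ← hfst,
    withDensity_apply _ (measurable_fst hs)]
  simp_rw [hexp]
  rw [← setLIntegral_map hs (hmeas.const_mul _) measurable_fst, Measure.map_fst_prod,
    Measure.restrict_smul, lintegral_smul_measure, lintegral_const_mul _ hmeas,
    Measure.smul_apply, expMeasure, withDensity_apply _ hs, ENNReal.div_eq_inv_mul]
  simp only [smul_eq_mul]
  ring

/-- The distance to the boundary of the model space is exponentially distributed with rate
`(n - 1) lam`. -/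
theorem map_toHeight_normVol (hn : 2 ≤ n) (hlam : 0 < lam) :
    (normVol n κ lam).map toHeight = expMeasure ((n - 1) * lam) := by
  have hΛ : 0 < ((n : ℝ) - 1) * lam := sub_one_mul_pos hn hlam
  have hmap := map_toHeight_vol (κ := κ) hn hlam
  set c := (volume : Measure (EuclideanSpace ℝ (Fin (n - 1 + 1)))).toSphere univ /
    ENNReal.ofReal ((n - 1) * lam)
  have hc0 : c ≠ 0 := ENNReal.div_ne_zero.2
    ⟨Measure.measure_univ_ne_zero.2 (Measure.toSphere_ne_zero _), ENNReal.ofReal_ne_top⟩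
  have hc : c ≠ ⊤ := ENNReal.div_ne_top (measure_ne_top _ _) (ENNReal.ofReal_pos.2 hΛ).ne'
  have huniv : vol n κ lam univ = c := by
    rw [← preimage_univ (f := toHeight), ← Measure.map_apply measurable_toHeight .univ, hmap,
      Measure.smul_apply, expMeasure_univ hΛ, smul_eq_mul, mul_one]
  rw [normVol, Measure.map_smul, hmap, huniv, smul_smul, ENNReal.inv_mul_cancel hc0 hc, one_smul]

/-- The observable inscribed radius of the warped product model space. -/
theorem obsInRad_eq (hn : 2 ≤ n) (hlam : 0 < lam) {η : ℝ} (hη : 0 < η) (hη1 : η ≤ 1) :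
    obsInRad (bdry n κ lam) (normVol n κ lam) η =
      ENNReal.ofReal (Real.log (1 / η) / ((n - 1) * lam)) := by
  rw [obsInRad_eq_partInRad_map lipschitzWith_toHeight (fun _ ↦ mem_bdry_iff.1)
    exists_bdry_edist_le_toHeight, map_toHeight_normVol hn hlam,
    partInRad_expMeasure (sub_one_mul_pos hn hlam) hη hη1]

end WarpedModel

/-! ### Boundary concentration families -/

/-- For `η ≥ 1` the empty set is admissible. -/
theorem obsInRad_eq_zero_of_one_le {X : Type*} [PseudoEMetricSpace X] [MeasurableSpace X]
    (bd : Set X) (μ : Measure X) {η : ℝ} (hη : 1 ≤ η) : obsInRad bd μ η = 0 := by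
  refine le_antisymm (iSup₂_le fun φ _ ↦ iSup_le fun _ ↦ ?_) zero_le
  refine (iInf₂_le ∅ MeasurableSet.empty).trans ((iInf_le _ ?_).trans ?_)
  · simp [ENNReal.ofReal_of_nonpos (sub_nonpos.2 hη)]
  · simp [inRad]

theorem isBoundaryConcentrationFamily_warpedModel_iff {κ lam : ℕ → ℝ}
    (hlam : ∀ n, 2 ≤ n → 0 < lam n) :
    IsBoundaryConcentrationFamily (fun n ↦ WarpedModel.bdry n (κ n) (lam n))
        (fun n ↦ WarpedModel.normVol n (κ n) (lam n)) ↔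
      Tendsto (fun n : ℕ ↦ (n : ℝ) * lam n) atTop atTop := by
  have hev : ∀ η : ℝ, 0 < η → η ≤ 1 →
      (fun n ↦ obsInRad (WarpedModel.bdry n (κ n) (lam n))
        (WarpedModel.normVol n (κ n) (lam n)) η) =ᶠ[atTop]
      fun n : ℕ ↦ ENNReal.ofReal (Real.log (1 / η) / ((n - 1) * lam n)) := fun η hη hη1 ↦ by
    filter_upwards [eventually_ge_atTop 2] with n hn
    exact WarpedModel.obsInRad_eq hn (hlam n hn) hη hη1
  have hiff : Tendsto (fun n : ℕ ↦ (n : ℝ) * lam n) atTop atTop ↔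
      Tendsto (fun n : ℕ ↦ ((n : ℝ) - 1) * lam n) atTop atTop := by
    refine ⟨fun h ↦ ?_, fun h ↦ ?_⟩
    · refine tendsto_atTop_mono' _ ?_ (h.const_mul_atTop (one_half_pos (α := ℝ)))
      filter_upwards [eventually_ge_atTop 2] with n hn
      have : (2 : ℝ) ≤ n := mod_cast hn
      nlinarith [hlam n hn]
    · refine tendsto_atTop_mono' _ ?_ h
      filter_upwards [eventually_ge_atTop 2] with n hn
      nlinarith [hlam n hn]
  rw [hiff]
  refine ⟨fun h ↦ ?_, fun h η hη ↦ ?_⟩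
  · -- At `η = e⁻¹` the logarithm is `1`.
    have he : Real.log (1 / Real.exp (-1)) = 1 := by simp
    have h1 := (h _ (Real.exp_pos (-1))).congr'
      (hev _ (Real.exp_pos _) (Real.exp_le_one_iff.2 (by norm_num)))
    rw [he] at h1
    have h2 := (ENNReal.tendsto_toReal ENNReal.zero_ne_top).comp h1
    have h3 : Tendsto (fun n : ℕ ↦ (((n : ℝ) - 1) * lam n)⁻¹) atTop (𝓝[>] 0) := by
      refine tendsto_nhdsWithin_iff.2 ⟨?_, ?_⟩
      · refine h2.congr' ?_
        filter_upwards [eventually_ge_atTop 2] with n hn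
        have := sub_one_mul_pos hn (hlam n hn)
        simp only [Function.comp_apply, one_div]
        exact ENNReal.toReal_ofReal (by positivity)
      · filter_upwards [eventually_ge_atTop 2] with n hn
        exact inv_pos.2 (sub_one_mul_pos hn (hlam n hn))
    exact h3.inv_tendsto_nhdsGT_zero.congr fun n ↦ inv_inv _
  · rcases le_total 1 η with h1 | h1
    · simp_rw [obsInRad_eq_zero_of_one_le _ _ h1]
      exact tendsto_const_nhds
    · refine Tendsto.congr' (hev η hη h1).symm ?_
      simpa using ENNReal.tendsto_ofReal (h.const_div_atTop (Real.log (1 / η)))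

end BoundaryConcentration
end

theorem mainTheorem12 :
    (∀ κ lam : ℝ, κ < 0 → lam = √|κ| → ∀ η : ℝ, 0 < η → η ≤ 1 →
      (∀ n : ℕ, 2 ≤ n →
        BoundaryConcentration.obsInRad
            (BoundaryConcentration.WarpedModel.bdry n (κ / (n : ℝ) ^ 2) (lam / (n : ℝ)))
            (BoundaryConcentration.WarpedModel.normVol n (κ / (n : ℝ) ^ 2) (lam / (n : ℝ))) η =
          ENNReal.ofReal ((n : ℝ) * Real.log (1 / η) / (((n : ℝ) - 1) * lam))) ∧
      Tendsto
        (fun n : ℕ ↦ BoundaryConcentration.obsInRad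
          (BoundaryConcentration.WarpedModel.bdry n (κ / (n : ℝ) ^ 2) (lam / (n : ℝ)))
          (BoundaryConcentration.WarpedModel.normVol n (κ / (n : ℝ) ^ 2) (lam / (n : ℝ))) η)
        atTop
        (𝓝 (BoundaryConcentration.partInRad {(0 : ℝ≥0)}
          (BoundaryConcentration.expMeasure lam) (1 - η))) ∧
      BoundaryConcentration.partInRad {(0 : ℝ≥0)} (BoundaryConcentration.expMeasure lam) (1 - η) =
        ENNReal.ofReal (1 / lam * Real.log (1 / η))) ∧
    (∀ κ lam : ℕ → ℝ, (∀ n : ℕ, 2 ≤ n → κ n < 0) → (∀ n : ℕ, 2 ≤ n → lam n = √|κ n|) →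
      (BoundaryConcentration.IsBoundaryConcentrationFamily
          (fun n ↦ BoundaryConcentration.WarpedModel.bdry n (κ n) (lam n))
          (fun n ↦ BoundaryConcentration.WarpedModel.normVol n (κ n) (lam n)) ↔
        Tendsto (fun n : ℕ ↦ (n : ℝ) * lam n) atTop atTop)) := by
  refine ⟨fun κ lam hκ hlam η hη hη1 ↦ ?_, fun κ lam hκ hlam ↦
    BoundaryConcentration.isBoundaryConcentrationFamily_warpedModel_iff fun n hn ↦ ?_⟩
  · have hpos : 0 < lam := hlam ▸ Real.sqrt_pos.2 (abs_pos.2 hκ.ne)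
    have hpart : BoundaryConcentration.partInRad {(0 : ℝ≥0)}
        (BoundaryConcentration.expMeasure lam) (1 - η) =
          ENNReal.ofReal (1 / lam * Real.log (1 / η)) := by
      rw [BoundaryConcentration.partInRad_expMeasure hpos hη hη1, one_div_mul_eq_div]
    have hobs (n : ℕ) (hn : 2 ≤ n) := BoundaryConcentration.WarpedModel.obsInRad_eq
      (κ := κ / (n : ℝ) ^ 2) (lam := lam / n) hn (by positivity) hη hη1
    have hval (n : ℕ) (hn : 2 ≤ n) : Real.log (1 / η) / (((n : ℝ) - 1) * (lam / n)) =
        (n : ℝ) / (n - 1) * (1 / lam * Real.log (1 / η)) := by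
      have : ((n : ℝ) - 1) ≠ 0 := by
        have : (2 : ℝ) ≤ n := mod_cast hn
        linarith
      field_simp
    refine ⟨fun n hn ↦ ?_, ?_, hpart⟩
    · rw [hobs n hn, hval n hn]
      congr 1
      field_simp
    · have hlim : Tendsto (fun n : ℕ ↦ (n : ℝ) / (n - 1)) atTop (𝓝 1) := by
        simpa [sub_eq_add_neg] using tendsto_natCast_div_add_atTop (-1 : ℝ)
      have hlim' := hlim.mul_const (1 / lam * Real.log (1 / η))
      rw [one_mul] at hlim'
      rw [hpart]
      refine Tendsto.congr' ?_ (ENNReal.tendsto_ofReal hlim')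
      filter_upwards [eventually_ge_atTop 2] with n hn
      rw [hobs n hn, hval n hn]
  · rw [hlam n hn]
    exact Real.sqrt_pos.2 (abs_pos.2 (hκ n hn).ne)
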